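/- Let $N\in\mathbb{N}$, let $a\in\mathbb{R}^N$ with $a_i\neq 0$ for all $i$, and let $\underline x,\overline x,\underline y,\overline y\in\mathbb{R}^N$ satisfy $\underline x_i<\overline x_i$ and $\underline y_i<\overline y_i$ for all $i$. Put $$\mathcal{S}_a=\Bigl\{(x,y)\in\mathbb{R}^N\times\mathbb{R}^N:\ \sum_{i=1}^N a_i x_i y_i=0,\ \ \underline x\le x\le\overline x,\ \ \underline y\le y\le\overline y\Bigr\},$$ where vector inequalities are componentwise. Then the convex hull $\operatorname{conv}(\mathcal{S}_a)$ is second-order cone representable, that is, there are $m,p\in\mathbb{N}$ and, for $j=1,\dots,p$, an affine map $A_j:\mathbb{R}^{2N}\times\mathbb{R}^m\to\mathbb{R}^{d_j}$ (with $d_j\in\mathbb{N}$, $d_j=0$ allowed) and an affine function $c_j:\mathbb{R}^{2N}\times\mathbb{R}^m\to\mathbb{R}$ such that $$\operatorname{conv}(\mathcal{S}_a)=\bigl\{z\in\mathbb{R}^{2N}:\ \exists\,u\in\mathbb{R}^m\ \ \|A_j(z,u)\|_2\le c_j(z,u)\ \text{ for } j=1,\dots,p\bigr\}.$$ -/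

import Mathlib

/-- A set `C` in a (finite-dimensional) real vector space `E` is second-order cone representable
if it is the projection of the solution set of a finite system of second-order cone constraints:
there are finitely many auxiliary real variables `u` and finitely many constraints
`‖A j (z, u)‖₂ ≤ c j (z, u)`, with `A j` affine into a Euclidean space and `c j` affine real-valued,
such that `z ∈ C` if and only if some `u` satisfies all of them. A constraint whose Euclidean space
has dimension `0` is a linear inequality `0 ≤ c j (z, u)`. -/
def IsSOCRepresentable {E : Type*} [AddCommGroup E] [Module ℝ E] (C : Set E) : Prop :=
  ∃ (m p : ℕ) (d : Fin p → ℕ)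
    (A : (j : Fin p) → (E × (Fin m → ℝ)) →ᵃ[ℝ] EuclideanSpace ℝ (Fin (d j)))
    (c : Fin p → ((E × (Fin m → ℝ)) →ᵃ[ℝ] ℝ)),
    C = {z : E | ∃ u : Fin m → ℝ, ∀ j : Fin p, ‖A j (z, u)‖ ≤ c j (z, u)}

/-- The set of `(x, y)` with `∑ i, a i * x i * y i = 0`, `xl ≤ x ≤ xu` and `yl ≤ y ≤ yu`
(componentwise). -/
def bilinearBoxSet {N : ℕ} (a xl xu yl yu : Fin N → ℝ) : Set ((Fin N → ℝ) × (Fin N → ℝ)) :=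
  {z | ∑ i, a i * z.1 i * z.2 i = 0 ∧
    (∀ i, xl i ≤ z.1 i ∧ z.1 i ≤ xu i) ∧ (∀ i, yl i ≤ z.2 i ∧ z.2 i ≤ yu i)}

/-! The set is compact, so its hull lies in the closed hull of its extreme points. If two coordinate
pairs are not vertices of their rectangles, each can move both ways along an axis, changing its term
`a i * x i * y i` affinely; combining the moves so that the changes cancel makes the point a
midpoint (`exists_ne_zero_add_sub_mem_bilinearBoxSet`). So at an extreme point all pairs but one are
vertices. Such points form finitely many pieces, each an affine image of a planar hyperbola in a
box.

The hull of a hyperbola arc is cut out by one cone constraint and its chord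
(`convexHull_hyperbola_arc`). Finite unions are handled by `IsSOCRepresentable.convexJoin`, which
needs boundedness; hence `HasSOCHull` carries compactness along, and this also makes the hull of the
union closed. -/

namespace IsSOCRepresentable

/-! ### Closure properties of representable sets -/

section Algebraic

variable {E F : Type*} [AddCommGroup E] [Module ℝ E] [AddCommGroup F] [Module ℝ F]

/-- The auxiliary variables may range over any finite-dimensional space, and the constraints may be
indexed by any finite type. -/
theorem of_finite [FiniteDimensional ℝ F] {ι : Type*} [Finite ι] (d : ι → ℕ)
    (A : (i : ι) → (E × F) →ᵃ[ℝ] EuclideanSpace ℝ (Fin (d i))) (c : ι → ((E × F) →ᵃ[ℝ] ℝ)) :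
    IsSOCRepresentable {z : E | ∃ u : F, ∀ i, ‖A i (z, u)‖ ≤ c i (z, u)} := by
  obtain ⟨p, ⟨σ⟩⟩ := Finite.exists_equiv_fin ι
  let e : (Fin (Module.finrank ℝ F) → ℝ) ≃ₗ[ℝ] F := (Module.finBasis ℝ F).equivFun.symm
  let g : (E × (Fin (Module.finrank ℝ F) → ℝ)) →ᵃ[ℝ] E × F :=
    (LinearMap.prodMap LinearMap.id e.toLinearMap).toAffineMap
  refine ⟨_, p, fun j => d (σ.symm j), fun j => (A (σ.symm j)).comp g,
    fun j => (c (σ.symm j)).comp g, ?_⟩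
  ext z
  constructor
  · rintro ⟨u, hu⟩
    exact ⟨e.symm u, fun j => by simpa [g] using hu (σ.symm j)⟩
  · rintro ⟨u, hu⟩
    refine ⟨e u, fun i => ?_⟩
    obtain ⟨j, rfl⟩ := σ.symm.surjective i
    exact hu j

theorem of_forall {ι : Type*} [Finite ι] (d : ι → ℕ)
    (A : (i : ι) → E →ᵃ[ℝ] EuclideanSpace ℝ (Fin (d i))) (c : ι → (E →ᵃ[ℝ] ℝ)) :
    IsSOCRepresentable {z : E | ∀ i, ‖A i z‖ ≤ c i z} := by
  have h := of_finite (F := Fin 0 → ℝ) d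
    (fun i => (A i).comp (LinearMap.fst ℝ E (Fin 0 → ℝ)).toAffineMap)
    (fun i => (c i).comp (LinearMap.fst ℝ E (Fin 0 → ℝ)).toAffineMap)
  simpa using h

theorem norm_le {d : ℕ} (A : E →ᵃ[ℝ] EuclideanSpace ℝ (Fin d)) (c : E →ᵃ[ℝ] ℝ) :
    IsSOCRepresentable {z : E | ‖A z‖ ≤ c z} := by
  simpa using of_forall (ι := Unit) (fun _ => d) (fun _ => A) (fun _ => c)

theorem halfspace (c : E →ᵃ[ℝ] ℝ) : IsSOCRepresentable {z : E | 0 ≤ c z} := by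
  simpa using norm_le (d := 0) 0 c

theorem empty : IsSOCRepresentable (∅ : Set E) := by
  have h := halfspace (AffineMap.const ℝ E (-1 : ℝ))
  have h0 : {z : E | 0 ≤ AffineMap.const ℝ E (-1 : ℝ) z} = ∅ := by
    ext z
    simp
  rwa [h0] at h

theorem univ : IsSOCRepresentable (Set.univ : Set E) := by
  simpa using halfspace (0 : E →ᵃ[ℝ] ℝ)

theorem preimage {C : Set F} (hC : IsSOCRepresentable C) (f : E →ᵃ[ℝ] F) :
    IsSOCRepresentable (f ⁻¹' C) := by
  obtain ⟨m, p, d, A, c, rfl⟩ := hC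
  exact ⟨m, p, d, fun j => (A j).comp (f.prodMap (AffineMap.id ℝ _)),
    fun j => (c j).comp (f.prodMap (AffineMap.id ℝ _)), rfl⟩

theorem inter {C D : Set E} (hC : IsSOCRepresentable C) (hD : IsSOCRepresentable D) :
    IsSOCRepresentable (C ∩ D) := by
  obtain ⟨m, p, d, A, c, rfl⟩ := hC
  obtain ⟨n, q, e, B, b, rfl⟩ := hD
  let f : E × ((Fin m → ℝ) × (Fin n → ℝ)) →ᵃ[ℝ] E × (Fin m → ℝ) :=
    (LinearMap.prodMap LinearMap.id (LinearMap.fst ℝ _ _)).toAffineMap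
  let g : E × ((Fin m → ℝ) × (Fin n → ℝ)) →ᵃ[ℝ] E × (Fin n → ℝ) :=
    (LinearMap.prodMap LinearMap.id (LinearMap.snd ℝ _ _)).toAffineMap
  have h := of_finite (ι := Fin p ⊕ Fin q) (Sum.elim d e)
    (fun i => match i with
      | .inl i => (A i).comp f
      | .inr i => (B i).comp g)
    (fun i => match i with
      | .inl i => (c i).comp f
      | .inr i => (b i).comp g)
  convert h using 1
  ext z
  constructor
  · rintro ⟨⟨u, hu⟩, v, hv⟩
    exact ⟨(u, v), Sum.rec hu hv⟩
  · rintro ⟨⟨u, v⟩, huv⟩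
    exact ⟨⟨u, fun i => huv (.inl i)⟩, v, fun i => huv (.inr i)⟩

theorem image [FiniteDimensional ℝ E] [FiniteDimensional ℝ F] {C : Set E}
    (hC : IsSOCRepresentable C) (f : E →ᵃ[ℝ] F) : IsSOCRepresentable (f '' C) := by
  obtain ⟨m, p, d, A, c, rfl⟩ := hC
  let e : F ≃ₗ[ℝ] EuclideanSpace ℝ (Fin (Module.finrank ℝ F)) :=
    (Module.finBasis ℝ F).equivFun.trans (WithLp.linearEquiv 2 ℝ _).symm
  -- The equation `z = f x` becomes the constraint `‖e (z - f x)‖ ≤ 0`, with `x` a new auxiliary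
  -- variable.
  let G : F × (E × (Fin m → ℝ)) →ᵃ[ℝ] EuclideanSpace ℝ (Fin (Module.finrank ℝ F)) :=
    e.toLinearMap.toAffineMap.comp ((LinearMap.fst ℝ F (E × (Fin m → ℝ))).toAffineMap -
      f.comp ((LinearMap.fst ℝ E (Fin m → ℝ)).comp (LinearMap.snd ℝ F _)).toAffineMap)
  have h := of_finite (ι := Option (Fin p))
    (fun i => i.elim (Module.finrank ℝ F) d)
    (fun i => match i with
      | none => G
      | some i => (A i).comp (LinearMap.snd ℝ F _).toAffineMap)
    (fun i => match i with
      | none => 0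
      | some i => (c i).comp (LinearMap.snd ℝ F _).toAffineMap)
  convert h using 1
  ext z
  have hG : ∀ x u, G (z, x, u) = e (z - f x) := fun _ _ => rfl
  constructor
  · rintro ⟨x, ⟨u, hu⟩, rfl⟩
    refine ⟨(x, u), Option.rec ?_ hu⟩
    change ‖G (f x, x, u)‖ ≤ 0
    simp [hG]
  · rintro ⟨⟨x, u⟩, hu⟩
    have h0 : ‖G (z, x, u)‖ ≤ 0 := hu none
    rw [hG, norm_le_zero_iff, LinearEquiv.map_eq_zero_iff, sub_eq_zero] at h0
    exact ⟨x, ⟨u, fun i => hu (some i)⟩, h0.symm⟩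

end Algebraic

/-! ### Homogenization and joins of bounded sets -/

section Cone

variable {V W : Type*} [AddCommGroup V] [Module ℝ V] [AddCommGroup W] [Module ℝ W]

/-- The linear map on `V × ℝ` whose restriction to height one is the affine map `A`. -/
def homogenize (A : V →ᵃ[ℝ] W) : V × ℝ →ₗ[ℝ] W :=
  A.linear.comp (LinearMap.fst ℝ V ℝ) + (LinearMap.snd ℝ V ℝ).smulRight (A 0)

theorem homogenize_smul (A : V →ᵃ[ℝ] W) (l : ℝ) (v : V) : homogenize A (l • v, l) = l • A v := by
  have h : A v = A.linear v + A 0 := congrFun (AffineMap.decomp A) v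
  simp [homogenize, h]

theorem apply_add_smul (A : V →ᵃ[ℝ] W) (t : ℝ) (v w : V) :
    A (v + t • w) = A v + t • homogenize A (w, 0) := by
  have h := A.map_vadd v (t • w)
  simp only [vadd_eq_add, map_smul] at h
  rw [add_comm v, h, add_comm]
  simp [homogenize]

variable {E : Type*} [NormedAddCommGroup E] [NormedSpace ℝ E]

theorem _root_.Bornology.IsBounded.eq_zero_of_forall_add_smul_mem {C : Set E}
    (hb : Bornology.IsBounded C) {x w : E} (h : ∀ t : ℝ, 0 ≤ t → x + t • w ∈ C) : w = 0 := by
  obtain ⟨R, hR⟩ := hb.exists_norm_le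
  by_contra hw
  have hw' : 0 < ‖w‖ := norm_pos_iff.mpr hw
  have hR0 : 0 ≤ R := (norm_nonneg _).trans (hR _ (h 0 le_rfl))
  have ht : 0 ≤ (R + ‖x‖ + 1) / ‖w‖ := by positivity
  have h1 := hR _ (h _ ht)
  have h2 : ‖((R + ‖x‖ + 1) / ‖w‖) • w‖ = R + ‖x‖ + 1 := by
    rw [norm_smul, Real.norm_of_nonneg ht, div_mul_cancel₀ _ hw'.ne']
  have h3 := norm_sub_le (x + ((R + ‖x‖ + 1) / ‖w‖) • w) x
  rw [add_sub_cancel_left, h2] at h3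
  linarith

/-- The cone over a nonempty bounded representable set is representable. -/
theorem cone {C : Set E} (hC : IsSOCRepresentable C) (hb : Bornology.IsBounded C)
    (hne : C.Nonempty) :
    IsSOCRepresentable {q : E × ℝ | 0 ≤ q.2 ∧ ∃ x ∈ C, q.1 = q.2 • x} := by
  obtain ⟨m, p, d, A, c, rfl⟩ := hC
  let g : (E × ℝ) × (Fin m → ℝ) →ₗ[ℝ] (E × (Fin m → ℝ)) × ℝ :=
    { toFun := fun q => ((q.1.1, q.2), q.1.2)
      map_add' := fun _ _ => rfl
      map_smul' := fun _ _ => rfl }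
  have h := (halfspace (LinearMap.snd ℝ E ℝ).toAffineMap).inter
    (of_finite (ι := Fin p) d (fun i => ((homogenize (A i)).comp g).toAffineMap)
      (fun i => ((homogenize (c i)).comp g).toAffineMap))
  convert h using 1
  ext ⟨w, l⟩
  simp only [Set.mem_ofPred_eq, Set.mem_inter_iff, LinearMap.coe_toAffineMap, LinearMap.snd_apply,
    LinearMap.comp_apply, g, LinearMap.coe_mk, AddHom.coe_mk]
  refine and_congr_right fun hl => ⟨?_, ?_⟩
  · rintro ⟨x, ⟨u, hu⟩, rfl⟩
    refine ⟨l • u, fun i => ?_⟩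
    rw [← Prod.smul_mk, homogenize_smul, homogenize_smul, norm_smul, Real.norm_of_nonneg hl]
    exact mul_le_mul_of_nonneg_left (hu i) hl
  · rintro ⟨u, hu⟩
    -- At height zero, `(w, u)` is a recession direction of the lifted set, so `w` is one of the
    -- bounded projection and vanishes. At positive height, rescale.
    rcases hl.eq_or_lt with rfl | hl
    · obtain ⟨x, hx⟩ := hne
      refine ⟨x, hx, ?_⟩
      rw [zero_smul]
      obtain ⟨v, hv⟩ := hx
      refine hb.eq_zero_of_forall_add_smul_mem (x := x) fun t ht => ⟨v + t • u, fun i => ?_⟩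
      have h1 : (x + t • w, v + t • u) = (x, v) + t • (w, u) := rfl
      rw [h1, apply_add_smul, apply_add_smul]
      calc ‖A i (x, v) + t • homogenize (A i) ((w, u), 0)‖
          ≤ ‖A i (x, v)‖ + ‖t • homogenize (A i) ((w, u), 0)‖ := norm_add_le _ _
        _ = ‖A i (x, v)‖ + t * ‖homogenize (A i) ((w, u), 0)‖ := by
          rw [norm_smul, Real.norm_of_nonneg ht]
        _ ≤ c i (x, v) + t • homogenize (c i) ((w, u), 0) :=
          add_le_add (hv i) (mul_le_mul_of_nonneg_left (hu i) ht)
    · refine ⟨l⁻¹ • w, ⟨l⁻¹ • u, fun i => ?_⟩, by rw [smul_inv_smul₀ hl.ne']⟩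
      have h1 : ((w, u), l) = (l • (l⁻¹ • w, l⁻¹ • u), l) := by
        rw [← Prod.smul_mk, smul_inv_smul₀ hl.ne']
      have h2 := hu i
      rw [h1, homogenize_smul, homogenize_smul, norm_smul, Real.norm_of_nonneg hl.le] at h2
      exact le_of_mul_le_mul_left h2 hl

/-- Writing `z = l • x + (1 - l) • y` and `w = l • x` removes the bilinear products: `(w, l)` lies
in the cone over `C` and `(z - w, 1 - l)` in the cone over `D`. -/
theorem convexJoin [FiniteDimensional ℝ E] {C D : Set E} (hC : IsSOCRepresentable C)
    (hD : IsSOCRepresentable D) (hCb : Bornology.IsBounded C) (hDb : Bornology.IsBounded D)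
    (hCne : C.Nonempty) (hDne : D.Nonempty) : IsSOCRepresentable (convexJoin ℝ C D) := by
  let g : E × (E × ℝ) →ᵃ[ℝ] E × ℝ :=
    (LinearMap.inl ℝ E ℝ).toAffineMap.comp (LinearMap.fst ℝ E (E × ℝ)).toAffineMap -
      (LinearMap.snd ℝ E (E × ℝ)).toAffineMap + AffineMap.const ℝ _ ((0 : E), (1 : ℝ))
  have h := (((hC.cone hCb hCne).preimage (LinearMap.snd ℝ E (E × ℝ)).toAffineMap).inter
    ((hD.cone hDb hDne).preimage g)).image (LinearMap.fst ℝ E (E × ℝ)).toAffineMap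
  convert h using 1
  ext z
  simp only [mem_convexJoin, segment, Set.mem_image, Set.mem_inter_iff, Set.mem_preimage,
    Set.mem_ofPred_eq, LinearMap.coe_toAffineMap, LinearMap.fst_apply, LinearMap.snd_apply]
  constructor
  · rintro ⟨x, hx, y, hy, a, b, ha, hb, hab, rfl⟩
    have hb' : b = 1 - a := by linarith
    refine ⟨(a • x + b • y, (a • x, a)), ⟨⟨ha, x, hx, rfl⟩, ?_, y, hy, ?_⟩, rfl⟩
    · simpa [g, hb'] using hb
    · simp [g, hb', neg_add_eq_sub]
  · rintro ⟨⟨z, w, l⟩, ⟨⟨hl, x, hx, h1⟩, hl', y, hy, h2⟩, rfl⟩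
    simp only [g, AffineMap.coe_add, AffineMap.coe_sub, Pi.add_apply, Pi.sub_apply,
      AffineMap.coe_comp, Function.comp_apply, LinearMap.coe_toAffineMap, LinearMap.fst_apply,
      LinearMap.snd_apply, LinearMap.inl_apply, AffineMap.const_apply, Prod.fst_add, Prod.snd_add,
      Prod.fst_sub, Prod.snd_sub, add_zero] at hl' h1 h2
    refine ⟨x, hx, y, hy, l, 0 - l + 1, hl, hl', by ring, ?_⟩
    rw [← h1, ← h2]
    abel

end Cone

end IsSOCRepresentable

/-! ### Compact representable hulls -/

section Hull

variable {E F : Type*} [NormedAddCommGroup E] [NormedSpace ℝ E]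
  [NormedAddCommGroup F] [NormedSpace ℝ F]

theorem IsCompact.convexJoin {C D : Set E} (hC : IsCompact C) (hD : IsCompact D) :
    IsCompact (convexJoin ℝ C D) := by
  have h := (hC.prod (hD.prod (isCompact_Icc (a := (0 : ℝ)) (b := 1)))).image
    (f := fun q : E × E × ℝ => (1 - q.2.2) • q.1 + q.2.2 • q.2.1) (by fun_prop)
  convert h using 1
  ext z
  simp only [mem_convexJoin, segment_eq_image, Set.mem_image, Set.mem_prod, Prod.exists]
  constructor
  · rintro ⟨x, hx, y, hy, t, ht, rfl⟩
    exact ⟨x, y, t, ⟨hx, hy, ht⟩, rfl⟩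
  · rintro ⟨x, y, t, ⟨hx, hy, ht⟩, rfl⟩
    exact ⟨x, hx, y, hy, t, ht, rfl⟩

/-- The convex hull of `C` is compact and second-order cone representable. -/
structure HasSOCHull (C : Set E) : Prop where
  isCompact : IsCompact (convexHull ℝ C)
  isSOCRepresentable : IsSOCRepresentable (convexHull ℝ C)

namespace HasSOCHull

theorem empty : HasSOCHull (∅ : Set E) :=
  ⟨by simp, by simpa using IsSOCRepresentable.empty⟩

theorem union [FiniteDimensional ℝ E] {C D : Set E} (hC : HasSOCHull C)
    (hD : HasSOCHull D) : HasSOCHull (C ∪ D) := by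
  rcases C.eq_empty_or_nonempty with rfl | hCne
  · simpa using hD
  rcases D.eq_empty_or_nonempty with rfl | hDne
  · simpa using hC
  refine ⟨?_, ?_⟩ <;> rw [convexHull_union hCne hDne]
  · exact hC.isCompact.convexJoin hD.isCompact
  · exact hC.isSOCRepresentable.convexJoin hD.isSOCRepresentable hC.isCompact.isBounded
      hD.isCompact.isBounded hCne.convexHull hDne.convexHull

theorem iUnion [FiniteDimensional ℝ E] {ι : Type*} [Finite ι] {C : ι → Set E}
    (h : ∀ i, HasSOCHull (C i)) :
    HasSOCHull (⋃ i, C i) := by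
  have key : ∀ s : Set ι, s.Finite → HasSOCHull (⋃ i ∈ s, C i) := by
    intro s hs
    induction s, hs using Set.Finite.induction_on with
    | empty => simpa using empty
    | insert _ _ ih =>
      rw [Set.biUnion_insert]
      exact (h _).union ih
  simpa using key Set.univ Set.finite_univ

theorem image [FiniteDimensional ℝ E] [FiniteDimensional ℝ F] {C : Set E}
    (hC : HasSOCHull C) (f : E →ᵃ[ℝ] F) : HasSOCHull (f '' C) := by
  refine ⟨?_, ?_⟩ <;> rw [← f.image_convexHull]
  · exact hC.isCompact.image f.continuous_of_finiteDimensional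
  · exact hC.isSOCRepresentable.image f

theorem of_singleton [FiniteDimensional ℝ E] (x : E) : HasSOCHull {x} := by
  have h := (IsSOCRepresentable.univ (E := E)).image (AffineMap.const ℝ E x)
  have hx : AffineMap.const ℝ E x '' Set.univ = {x} := Set.univ_nonempty.image_const x
  rw [hx] at h
  exact ⟨by simp, by simpa using h⟩

theorem segment [FiniteDimensional ℝ E] (x y : E) : HasSOCHull (segment ℝ x y) := by
  have h := (of_singleton x).union (of_singleton y)
  rw [Set.singleton_union] at h
  rw [← convexHull_pair]
  refine ⟨?_, ?_⟩ <;> rw [(convex_convexHull ℝ _).convexHull_eq]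
  exacts [h.isCompact, h.isSOCRepresentable]

end HasSOCHull

end Hull

/-! ### Planar hyperbolas in boxes -/

/-- Since `(s + t)² - (s - t)² = 4 * s * t`, the constraint is `‖(2√c, s - t)‖ ≤ s + t`. -/
theorem isSOCRepresentable_hyperbola {c : ℝ} (hc : 0 ≤ c) :
    IsSOCRepresentable {z : ℝ × ℝ | 0 ≤ z.1 ∧ 0 ≤ z.2 ∧ c ≤ z.1 * z.2} := by
  let A : ℝ × ℝ →ᵃ[ℝ] EuclideanSpace ℝ (Fin 2) :=
    (WithLp.linearEquiv 2 ℝ (Fin 2 → ℝ)).symm.toLinearMap.toAffineMap.comp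
      (AffineMap.pi ![AffineMap.const ℝ _ (2 * √c),
        (LinearMap.fst ℝ ℝ ℝ - LinearMap.snd ℝ ℝ ℝ).toAffineMap])
  have h := IsSOCRepresentable.norm_le A (LinearMap.fst ℝ ℝ ℝ + LinearMap.snd ℝ ℝ ℝ).toAffineMap
  convert h using 1
  ext ⟨s, t⟩
  have hA0 : A (s, t) 0 = 2 * √c := rfl
  have hA1 : A (s, t) 1 = s - t := rfl
  simp only [Set.mem_ofPred_eq, LinearMap.coe_toAffineMap, LinearMap.add_apply,
    LinearMap.fst_apply, LinearMap.snd_apply, EuclideanSpace.norm_eq, Fin.sum_univ_two, hA0, hA1,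
    Real.norm_eq_abs, sq_abs, mul_pow, Real.sq_sqrt hc]
  rw [Real.sqrt_le_iff]
  constructor
  · rintro ⟨hs, ht, hst⟩
    exact ⟨add_nonneg hs ht, by linarith [sq_nonneg (s - t)]⟩
  · rintro ⟨h0, h1⟩
    have hst : c ≤ s * t := by linarith
    refine ⟨?_, ?_, hst⟩ <;> by_contra! hneg <;> nlinarith

/-- The last inequality is the half-plane below the chord joining the arc's endpoints. Each point
between arc and chord lies on a vertical segment from one to the other. -/
theorem convexHull_hyperbola_arc {c α β : ℝ} (hc : 0 < c) (hα : 0 < α) (hαβ : α ≤ β) :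
    convexHull ℝ {z : ℝ × ℝ | z.1 ∈ Set.Icc α β ∧ z.1 * z.2 = c} =
      {z : ℝ × ℝ | 0 ≤ z.1 ∧ 0 ≤ z.2 ∧ c ≤ z.1 * z.2} ∩
        {z : ℝ × ℝ | 0 ≤ c * (α + β - z.1) - α * β * z.2} := by
  have hβ : 0 < β := hα.trans_le hαβ
  apply Set.Subset.antisymm
  · refine convexHull_min ?_ (Convex.inter ?_ ?_)
    · rintro ⟨s, t⟩ ⟨⟨h1, h2⟩, h3⟩
      dsimp only at h1 h2 h3
      have hs : 0 < s := hα.trans_le h1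
      have ht : 0 < t := by
        by_contra! h
        nlinarith
      refine ⟨⟨hs.le, ht.le, h3.ge⟩, ?_⟩
      have h4 : 0 ≤ t * ((s - α) * (β - s)) :=
        mul_nonneg ht.le (mul_nonneg (by linarith) (by linarith))
      simp only [Set.mem_ofPred_eq, ← h3]
      linarith
    · rintro ⟨s, t⟩ ⟨hs, ht, h⟩ ⟨s', t'⟩ ⟨hs', ht', h'⟩ p q hp hq hpq
      dsimp only at hs ht h hs' ht' h'
      have hx : 0 ≤ s * t' := mul_nonneg hs ht'
      have hy : 0 ≤ s' * t := mul_nonneg hs' ht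
      have hxy : c * c ≤ (s * t') * (s' * t) := by
        have := mul_le_mul h h' hc.le (hc.le.trans h)
        linarith
      -- AM-GM, as the two summands have product at least `c²`.
      have hsum : 2 * c ≤ s * t' + s' * t := by
        by_contra! hlt
        nlinarith [sq_nonneg (s * t' - s' * t)]
      refine ⟨by dsimp; positivity, by dsimp; positivity, ?_⟩
      have hpq0 : 0 ≤ p * q := mul_nonneg hp hq
      have hq' : q = 1 - p := by linarith
      have e1 := mul_le_mul_of_nonneg_left h (mul_nonneg hp hp)
      have e2 := mul_le_mul_of_nonneg_left h' (mul_nonneg hq hq)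
      have e3 := mul_le_mul_of_nonneg_left hsum hpq0
      have e4 : c = p * p * c + q * q * c + p * q * (2 * c) := by
        subst hq'
        ring
      simp only [Prod.smul_mk, Prod.mk_add_mk, smul_eq_mul]
      linarith
    · rintro ⟨s, t⟩ h ⟨s', t'⟩ h' p q hp hq hpq
      simp only [Set.mem_ofPred_eq, Prod.smul_mk, Prod.mk_add_mk, smul_eq_mul] at h h' ⊢
      have e1 := mul_nonneg hp h
      have e2 := mul_nonneg hq h'
      have hq' : q = 1 - p := by linarith
      subst hq'
      linarith
  · rintro ⟨s, t⟩ ⟨⟨hs0, ht, hst⟩, hch⟩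
    simp only [Set.mem_ofPred_eq] at hs0 ht hst hch
    have hs : 0 < s := by
      rcases hs0.eq_or_lt with rfl | h
      · linarith
      · exact h
    -- The chord inequality times `s`, with `c ≤ s * t` substituted, forces `s` between `α` and `β`.
    have hprod : 0 ≤ (s - α) * (β - s) := by
      have h1 := mul_nonneg hs0 hch
      have h2 := mul_le_mul_of_nonneg_left hst (mul_pos hα hβ).le
      have h3 : 0 ≤ c * ((s - α) * (β - s)) := by linarith
      exact nonneg_of_mul_nonneg_right h3 hc
    have hsα : α ≤ s := by
      by_contra! h
      nlinarith
    have hsβ : s ≤ β := by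
      by_contra! h
      nlinarith
    set S := convexHull ℝ {z : ℝ × ℝ | z.1 ∈ Set.Icc α β ∧ z.1 * z.2 = c} with hS
    have hconv : Convex ℝ S := convex_convexHull ℝ _
    have hmem : ∀ r ∈ Set.Icc α β, (r, c / r) ∈ S := fun r hr =>
      subset_convexHull ℝ _ ⟨hr, mul_div_cancel₀ _ (hα.trans_le hr.1).ne'⟩
    have hchord : (s, c * (α + β - s) / (α * β)) ∈ S := by
      rcases hαβ.eq_or_lt with rfl | hlt
      · have : s = α := le_antisymm hsβ hsα
        subst this
        convert hmem s ⟨le_rfl, le_rfl⟩ using 2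
        field_simp
        ring
      · have hd : 0 < β - α := sub_pos.mpr hlt
        have := hconv (hmem α ⟨le_rfl, hαβ⟩) (hmem β ⟨hαβ, le_rfl⟩)
          (a := (β - s) / (β - α)) (b := (s - α) / (β - α)) (div_nonneg (by linarith) hd.le)
          (div_nonneg (by linarith) hd.le) (by field_simp; ring)
        convert this using 1
        ext
        · simp only [Prod.smul_mk, Prod.mk_add_mk, smul_eq_mul]
          field_simp
          ring
        · simp only [Prod.smul_mk, Prod.mk_add_mk, smul_eq_mul]
          field_simp
          ring
    have hlow : c / s ≤ t := by
      rw [div_le_iff₀ hs]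
      linarith
    have hup : t ≤ c * (α + β - s) / (α * β) := by
      rw [le_div_iff₀ (mul_pos hα hβ)]
      linarith
    have hseg : (s, t) ∈ segment ℝ (s, c / s) (s, c * (α + β - s) / (α * β)) := by
      rw [← Prod.image_mk_segment_right, segment_eq_Icc (hlow.trans hup)]
      exact ⟨t, ⟨hlow, hup⟩, rfl⟩
    exact hconv.segment_subset (hmem s ⟨hsα, hsβ⟩) hchord hseg

theorem HasSOCHull.hyperbola_arc {c α β : ℝ} (hc : 0 < c) (hα : 0 < α) :
    HasSOCHull {z : ℝ × ℝ | z.1 ∈ Set.Icc α β ∧ z.1 * z.2 = c} := by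
  rcases lt_or_ge β α with h | hαβ
  · simpa [Set.Icc_eq_empty_of_lt h] using HasSOCHull.empty
  refine ⟨?_, ?_⟩
  · refine Metric.isCompact_of_isClosed_isBounded ?_ ?_
    · rw [convexHull_hyperbola_arc hc hα hαβ]
      exact ((isClosed_le continuous_const continuous_fst).inter
        ((isClosed_le continuous_const continuous_snd).inter
          (isClosed_le continuous_const (continuous_fst.mul continuous_snd)))).inter
            (isClosed_le continuous_const (by fun_prop))
    · rw [isBounded_convexHull]
      refine (Metric.isBounded_Icc (α, 0) (β, c / α)).subset ?_
      rintro ⟨s, t⟩ ⟨⟨h1, h2⟩, h3⟩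
      dsimp only at h1 h2 h3
      have hs : 0 < s := hα.trans_le h1
      have ht : t = c / s := by
        rw [← h3]
        field_simp
      refine ⟨⟨h1, ?_⟩, ⟨h2, ?_⟩⟩
      · rw [ht]
        exact (div_pos hc hs).le
      · rw [ht]
        exact div_le_div_of_nonneg_left hc.le hα h1
  · rw [convexHull_hyperbola_arc hc hα hαβ]
    refine (isSOCRepresentable_hyperbola hc.le).inter ?_
    convert IsSOCRepresentable.halfspace (AffineMap.const ℝ (ℝ × ℝ) (c * (α + β)) -
      (c • LinearMap.fst ℝ ℝ ℝ + (α * β) • LinearMap.snd ℝ ℝ ℝ).toAffineMap) using 4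
    simp
    ring

/-- The points of a box on the hyperbola `s * t = c`. -/
def hyperbolaBox (c l u l' u' : ℝ) : Set (ℝ × ℝ) :=
  {z | z.1 * z.2 = c ∧ (l ≤ z.1 ∧ z.1 ≤ u) ∧ (l' ≤ z.2 ∧ z.2 ≤ u')}

namespace HasSOCHull

/-- On this branch `t = c / s`, so `t ≤ u'` means `c / u' ≤ s`, and `l' ≤ t` means `s ≤ c / l'` if
`0 < l'` and is vacuous otherwise. -/
theorem hyperbolaBox_inter_pos {c : ℝ} (hc : 0 < c) (l u l' u' : ℝ) :
    HasSOCHull (hyperbolaBox c l u l' u' ∩ {z | 0 < z.1}) := by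
  by_cases hu' : 0 < u'
  swap
  · convert HasSOCHull.empty (E := ℝ × ℝ)
    rw [Set.eq_empty_iff_forall_notMem]
    rintro ⟨s, t⟩ ⟨⟨h, -, ht⟩, hs⟩
    simp only [Set.mem_ofPred_eq] at h ht hs
    nlinarith
  have hα : 0 < max l (c / u') := lt_max_of_lt_right (div_pos hc hu')
  by_cases hl' : 0 < l'
  · convert hyperbola_arc (β := min u (c / l')) hc hα using 1
    ext ⟨s, t⟩
    simp only [hyperbolaBox, Set.mem_inter_iff, Set.mem_ofPred_eq, Set.mem_Icc, max_le_iff,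
      le_min_iff, div_le_iff₀ hu', le_div_iff₀ hl']
    constructor
    · rintro ⟨⟨rfl, ⟨h1, h2⟩, h3, h4⟩, hs⟩
      exact ⟨⟨⟨h1, mul_le_mul_of_nonneg_left h4 hs.le⟩, h2,
        mul_le_mul_of_nonneg_left h3 hs.le⟩, rfl⟩
    · rintro ⟨⟨⟨h1, h2⟩, h3, h4⟩, rfl⟩
      have hs : 0 < s := by
        by_contra! h
        nlinarith
      exact ⟨⟨rfl, ⟨h1, h3⟩, le_of_mul_le_mul_left h4 hs, le_of_mul_le_mul_left h2 hs⟩, hs⟩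
  · convert hyperbola_arc (β := u) hc hα using 1
    ext ⟨s, t⟩
    simp only [hyperbolaBox, Set.mem_inter_iff, Set.mem_ofPred_eq, Set.mem_Icc, max_le_iff,
      div_le_iff₀ hu']
    constructor
    · rintro ⟨⟨rfl, ⟨h1, h2⟩, h3, h4⟩, hs⟩
      exact ⟨⟨⟨h1, mul_le_mul_of_nonneg_left h4 hs.le⟩, h2⟩, rfl⟩
    · rintro ⟨⟨⟨h1, h2⟩, h3⟩, rfl⟩
      have hs : 0 < s := by
        by_contra! h
        nlinarith
      have ht : 0 < t := pos_of_mul_pos_right hc hs.le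
      exact ⟨⟨rfl, ⟨h1, h3⟩, by linarith, le_of_mul_le_mul_left h2 hs⟩, hs⟩

theorem hyperbolaBox_of_pos {c : ℝ} (hc : 0 < c) (l u l' u' : ℝ) :
    HasSOCHull (hyperbolaBox c l u l' u') := by
  -- The point reflection `z ↦ -z` exchanges the two branches.
  have h := (hyperbolaBox_inter_pos hc l u l' u').union
    ((hyperbolaBox_inter_pos hc (-u) (-l) (-u') (-l')).image
      (-LinearMap.id (R := ℝ) (M := ℝ × ℝ)).toAffineMap)
  convert h using 1
  ext ⟨s, t⟩
  simp only [hyperbolaBox, Set.mem_union, Set.mem_inter_iff, Set.mem_image, Set.mem_ofPred_eq,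
    LinearMap.coe_toAffineMap, LinearMap.neg_apply, LinearMap.id_apply]
  constructor
  · rintro ⟨h, ⟨h1, h2⟩, h3, h4⟩
    rcases lt_trichotomy s 0 with hs | rfl | hs
    · exact Or.inr ⟨(-s, -t), ⟨⟨by linarith, ⟨by linarith, by linarith⟩, by linarith, by linarith⟩,
        by linarith⟩, by simp⟩
    · linarith
    · exact Or.inl ⟨⟨h, ⟨h1, h2⟩, h3, h4⟩, hs⟩
  · rintro (h | ⟨⟨s', t'⟩, ⟨⟨h, ⟨h1, h2⟩, h3, h4⟩, hs⟩, h5⟩)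
    · exact h.1
    · simp only [Prod.neg_mk, Prod.mk.injEq] at h5
      obtain ⟨rfl, rfl⟩ := h5
      dsimp only at h h1 h2 h3 h4
      exact ⟨by linarith, ⟨by linarith, by linarith⟩, by linarith, by linarith⟩

theorem prod_Icc_singleton_zero (l u l' u' : ℝ) :
    HasSOCHull {z : ℝ × ℝ | z.2 = 0 ∧ (l ≤ z.1 ∧ z.1 ≤ u) ∧ (l' ≤ z.2 ∧ z.2 ≤ u')} := by
  by_cases h0 : l ≤ u ∧ l' ≤ 0 ∧ 0 ≤ u'
  · convert HasSOCHull.segment (l, (0 : ℝ)) (u, (0 : ℝ))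
    rw [← Prod.image_mk_segment_left, segment_eq_Icc h0.1]
    ext ⟨s, t⟩
    simp only [Set.mem_ofPred_eq, Set.mem_image, Set.mem_Icc, Prod.mk.injEq]
    constructor
    · rintro ⟨rfl, h, -⟩
      exact ⟨s, h, rfl, rfl⟩
    · rintro ⟨s, h, rfl, rfl⟩
      exact ⟨rfl, h, h0.2⟩
  · convert HasSOCHull.empty (E := ℝ × ℝ)
    rw [Set.eq_empty_iff_forall_notMem]
    rintro ⟨s, t⟩ ⟨rfl, h1, h2⟩
    exact h0 ⟨h1.1.trans h1.2, h2⟩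

theorem hyperbolaBox (c l u l' u' : ℝ) : HasSOCHull (hyperbolaBox c l u l' u') := by
  -- Reflecting the first coordinate reverses the sign of `c`; for `c = 0` the hyperbola degenerates
  -- to the two axes.
  rcases lt_trichotomy c 0 with hc | rfl | hc
  · convert (hyperbolaBox_of_pos (neg_pos.mpr hc) (-u) (-l) l' u').image
      (LinearMap.prodMap (-LinearMap.id (R := ℝ) (M := ℝ)) LinearMap.id).toAffineMap using 1
    ext ⟨s, t⟩
    simp only [_root_.hyperbolaBox, Set.mem_image, Set.mem_ofPred_eq, LinearMap.coe_toAffineMap,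
      LinearMap.prodMap_apply, LinearMap.neg_apply, LinearMap.id_apply, Prod.mk.injEq]
    constructor
    · rintro ⟨h, ⟨h1, h2⟩, h3⟩
      exact ⟨(-s, t), ⟨by linarith, ⟨by linarith, by linarith⟩, h3⟩, by simp, rfl⟩
    · rintro ⟨⟨s', t'⟩, ⟨h, ⟨h1, h2⟩, h3⟩, h4, h5⟩
      dsimp only at h h1 h2 h3 h4 h5
      subst h4 h5
      exact ⟨by linarith, ⟨by linarith, by linarith⟩, h3⟩
  · convert (prod_Icc_singleton_zero l u l' u').union ((prod_Icc_singleton_zero l' u' l u).image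
      (LinearEquiv.prodComm ℝ ℝ ℝ).toLinearMap.toAffineMap) using 1
    ext ⟨s, t⟩
    simp only [_root_.hyperbolaBox, Set.mem_union, Set.mem_image, Set.mem_ofPred_eq, mul_eq_zero,
      LinearMap.coe_toAffineMap, LinearEquiv.coe_coe, LinearEquiv.prodComm_apply, Prod.exists,
      Prod.swap_prod_mk, Prod.mk.injEq]
    constructor
    · rintro ⟨h | h, h1, h2⟩
      · exact Or.inr ⟨t, s, ⟨h, h2, h1⟩, rfl, rfl⟩
      · exact Or.inl ⟨h, h1, h2⟩
    · rintro (⟨h, h1, h2⟩ | ⟨t', s', ⟨h, h2, h1⟩, rfl, rfl⟩)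
      · exact ⟨Or.inr h, h1, h2⟩
      · exact ⟨Or.inl h, h1, h2⟩
  · exact hyperbolaBox_of_pos hc l u l' u'

end HasSOCHull

/-! ### Extreme points of the bilinear set -/

/-- Away from the vertices some coordinate is strictly inside its interval; moving it alone keeps
the product affine in `r`. -/
theorem exists_free_direction {a l u l' u' s t : ℝ} (hs : l ≤ s ∧ s ≤ u) (ht : l' ≤ t ∧ t ≤ u')
    (h : ¬((s = l ∨ s = u) ∧ (t = l' ∨ t = u'))) :
    ∃ p q w ε : ℝ, (p ≠ 0 ∨ q ≠ 0) ∧ 0 < ε ∧ ∀ r : ℝ, |r| ≤ ε →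
      (l ≤ s + r * p ∧ s + r * p ≤ u) ∧ (l' ≤ t + r * q ∧ t + r * q ≤ u') ∧
      a * (s + r * p) * (t + r * q) = a * s * t + r * w := by
  by_cases h1 : s = l ∨ s = u
  · have h2 : ¬(t = l' ∨ t = u') := fun h2 => h ⟨h1, h2⟩
    push Not at h2
    have hl : l' < t := lt_of_le_of_ne ht.1 h2.1.symm
    have hu : t < u' := lt_of_le_of_ne ht.2 h2.2
    refine ⟨0, 1, a * s, min (t - l') (u' - t), Or.inr one_ne_zero,
      lt_min (by linarith) (by linarith), fun r hr => ?_⟩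
    have h3 := abs_le.mp (hr.trans (min_le_left _ _))
    have h4 := abs_le.mp (hr.trans (min_le_right _ _))
    exact ⟨by simpa using hs, ⟨by linarith, by linarith⟩, by ring⟩
  · push Not at h1
    have hl : l < s := lt_of_le_of_ne hs.1 h1.1.symm
    have hu : s < u := lt_of_le_of_ne hs.2 h1.2
    refine ⟨1, 0, a * t, min (s - l) (u - s), Or.inl one_ne_zero,
      lt_min (by linarith) (by linarith), fun r hr => ?_⟩
    have h3 := abs_le.mp (hr.trans (min_le_left _ _))
    have h4 := abs_le.mp (hr.trans (min_le_right _ _))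
    exact ⟨⟨by linarith, by linarith⟩, by simpa using ht, by ring⟩

theorem exists_small_ne_zero_combination (v w : ℝ) {ε δ : ℝ} (hε : 0 < ε) (hδ : 0 < δ) :
    ∃ r s : ℝ, (r ≠ 0 ∨ s ≠ 0) ∧ |r| ≤ ε ∧ |s| ≤ δ ∧ r * v + s * w = 0 := by
  by_cases h : v = 0
  · exact ⟨ε, 0, Or.inl hε.ne', (abs_of_pos hε).le, by simpa using hδ.le, by simp [h]⟩
  · have hD : 0 < 1 + |v| + |w| := by positivity
    -- The solution `(w, -v)` is scaled by `τ` to meet both bounds; the `1` keeps the denominator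
    -- visibly positive.
    set τ := min ε δ / (1 + |v| + |w|) with hτ
    have hτ0 : 0 < τ := div_pos (lt_min hε hδ) hD
    have hτ1 : τ * (1 + |v| + |w|) = min ε δ := div_mul_cancel₀ _ hD.ne'
    have hv : τ * |v| ≤ min ε δ := by
      rw [← hτ1]
      exact mul_le_mul_of_nonneg_left (by linarith [abs_nonneg w]) hτ0.le
    have hw : τ * |w| ≤ min ε δ := by
      rw [← hτ1]
      exact mul_le_mul_of_nonneg_left (by linarith [abs_nonneg v]) hτ0.le
    refine ⟨τ * w, -(τ * v), Or.inr (neg_ne_zero.mpr (mul_ne_zero hτ0.ne' h)), ?_, ?_, by ring⟩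
    · rw [abs_mul, abs_of_pos hτ0]
      exact hw.trans (min_le_left _ _)
    · rw [abs_neg, abs_mul, abs_of_pos hτ0]
      exact hv.trans (min_le_right _ _)

/-- The inclusion in the Krein-Milman theorem that holds without convexity. -/
theorem IsCompact.subset_closure_convexHull_extremePoints {E : Type*} [AddCommGroup E]
    [Module ℝ E] [TopologicalSpace E] [T2Space E] [IsTopologicalAddGroup E] [ContinuousSMul ℝ E]
    [LocallyConvexSpace ℝ E] {s : Set E} (hs : IsCompact s) :
    s ⊆ closure (convexHull ℝ (s.extremePoints ℝ)) := by
  by_contra h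
  obtain ⟨x, hxs, hx⟩ := Set.not_subset.1 h
  obtain ⟨l, r, hlr, hrx⟩ :=
    geometric_hahn_banach_closed_point (convex_convexHull _ _).closure isClosed_closure hx
  -- An extreme point of this face is extreme in `s`, yet `l` is at least `l x` there.
  have he : IsExposed ℝ s {y ∈ s | ∀ z ∈ s, l z ≤ l y} := fun _ => ⟨l, rfl⟩
  obtain ⟨z, hzs, hz⟩ := hs.exists_isMaxOn ⟨x, hxs⟩ l.continuous.continuousOn
  obtain ⟨y, hy⟩ := (he.isCompact hs).extremePoints_nonempty ⟨z, hzs, hz⟩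
  linarith [hlr _ (subset_closure <| subset_convexHull _ _ <|
    he.isExtreme.extremePoints_subset_extremePoints hy), hy.1.2 x hxs]

section

variable {N : ℕ} (a xl xu yl yu : Fin N → ℝ)

/-- The points of `bilinearBoxSet` all of whose coordinate pairs, but at most one, are at vertices
of their boxes. -/
def bilinearBoxSkeleton : Set ((Fin N → ℝ) × (Fin N → ℝ)) :=
  {z ∈ bilinearBoxSet a xl xu yl yu | ∃ i, ∀ j, j ≠ i →
    (z.1 j = xl j ∨ z.1 j = xu j) ∧ (z.2 j = yl j ∨ z.2 j = yu j)}

variable {a xl xu yl yu}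

theorem exists_ne_zero_add_sub_mem_bilinearBoxSet {z : (Fin N → ℝ) × (Fin N → ℝ)}
    (hz : z ∈ bilinearBoxSet a xl xu yl yu) {i j : Fin N} (hij : i ≠ j)
    (hi : ¬((z.1 i = xl i ∨ z.1 i = xu i) ∧ (z.2 i = yl i ∨ z.2 i = yu i)))
    (hj : ¬((z.1 j = xl j ∨ z.1 j = xu j) ∧ (z.2 j = yl j ∨ z.2 j = yu j))) :
    ∃ e ≠ 0, z + e ∈ bilinearBoxSet a xl xu yl yu ∧ z - e ∈ bilinearBoxSet a xl xu yl yu := by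
  obtain ⟨hz0, hx, hy⟩ := hz
  obtain ⟨p, q, v, ε, hpq, hε, H⟩ := exists_free_direction (a := a i) (hx i) (hy i) hi
  obtain ⟨p', q', w, δ, hpq', hδ, H'⟩ := exists_free_direction (a := a j) (hx j) (hy j) hj
  obtain ⟨r, s, hrs, hr, hs, hsum⟩ := exists_small_ne_zero_combination v w hε hδ
  let e : ℝ → (Fin N → ℝ) × (Fin N → ℝ) := fun σ =>
    (fun k => if k = i then σ * r * p else if k = j then σ * s * p' else 0,
      fun k => if k = i then σ * r * q else if k = j then σ * s * q' else 0)
  -- Both signs at once: the sum changes by `σ * (r * v + s * w) = 0`.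
  have key : ∀ σ : ℝ, |σ| = 1 → z + e σ ∈ bilinearBoxSet a xl xu yl yu := by
    intro σ hσ
    have hr' := H (σ * r) (by rw [abs_mul, hσ, one_mul]; exact hr)
    have hs' := H' (σ * s) (by rw [abs_mul, hσ, one_mul]; exact hs)
    have hbox : ∀ k, (xl k ≤ (z + e σ).1 k ∧ (z + e σ).1 k ≤ xu k) ∧
        (yl k ≤ (z + e σ).2 k ∧ (z + e σ).2 k ≤ yu k) ∧
        a k * (z + e σ).1 k * (z + e σ).2 k = a k * z.1 k * z.2 k +
          ((if k = i then σ * r * v else 0) + if k = j then σ * s * w else 0) := by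
      intro k
      by_cases hki : k = i
      · subst hki
        simpa [e, hij] using hr'
      · by_cases hkj : k = j
        · subst hkj
          simpa [e, hki] using hs'
        · simpa [e, hki, hkj] using ⟨hx k, hy k⟩
    refine ⟨?_, fun k => (hbox k).1, fun k => (hbox k).2.1⟩
    rw [Finset.sum_congr rfl fun k _ => (hbox k).2.2]
    simp only [Finset.sum_add_distrib, hz0, Finset.sum_ite_eq', Finset.mem_univ, if_true]
    linear_combination σ * hsum
  refine ⟨e 1, ?_, key 1 (by simp), ?_⟩
  · intro h0
    have hi1 := congrFun (congrArg Prod.fst h0) i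
    have hi2 := congrFun (congrArg Prod.snd h0) i
    have hj1 := congrFun (congrArg Prod.fst h0) j
    have hj2 := congrFun (congrArg Prod.snd h0) j
    simp only [e, if_true, hij.symm, if_false, one_mul, Prod.fst_zero, Prod.snd_zero,
      Pi.zero_apply, mul_eq_zero] at hi1 hi2 hj1 hj2
    tauto
  · have h1 : z - e 1 = z + e (-1) := by
      rw [sub_eq_add_neg]
      congr 1
      ext k <;> simp only [e, Prod.fst_neg, Prod.snd_neg, Pi.neg_apply] <;> split_ifs <;> ring
    rw [h1]
    exact key (-1) (by simp)

theorem extremePoints_bilinearBoxSet_subset (hN : 0 < N) :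
    (bilinearBoxSet a xl xu yl yu).extremePoints ℝ ⊆
      bilinearBoxSkeleton a xl xu yl yu := by
  intro z hz
  refine ⟨hz.1, ?_⟩
  by_contra! hne
  -- Index `0` is only a seed: it yields a non-vertex pair `i`, and `i` then yields a second one.
  obtain ⟨i, -, hi⟩ := hne ⟨0, hN⟩
  obtain ⟨j, hji, hj⟩ := hne i
  obtain ⟨e, he, h1, h2⟩ := exists_ne_zero_add_sub_mem_bilinearBoxSet hz.1 hji.symm
    (fun h => by have := hi h.1; tauto) (fun h => by have := hj h.1; tauto)
  refine he (add_eq_left.mp (hz.2 h1 h2 ?_))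
  refine ⟨1 / 2, 1 / 2, by norm_num, by norm_num, by norm_num, ?_⟩
  module

theorem isCompact_bilinearBoxSet : IsCompact (bilinearBoxSet a xl xu yl yu) := by
  have hbox : IsCompact (Set.Icc xl xu ×ˢ Set.Icc yl yu) := isCompact_Icc.prod isCompact_Icc
  have hcl : IsClosed {z : (Fin N → ℝ) × (Fin N → ℝ) | ∑ i, a i * z.1 i * z.2 i = 0} :=
    isClosed_eq (by fun_prop) continuous_const
  convert hbox.inter_left hcl using 1
  ext z
  simp only [bilinearBoxSet, forall_and]
  rfl

theorem convexHull_bilinearBoxSet_eq (hN : 0 < N)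
    (hc : IsClosed (convexHull ℝ (bilinearBoxSkeleton a xl xu yl yu))) :
    convexHull ℝ (bilinearBoxSet a xl xu yl yu) =
      convexHull ℝ (bilinearBoxSkeleton a xl xu yl yu) := by
  refine Set.Subset.antisymm ?_ (convexHull_mono fun z hz => hz.1)
  refine convexHull_min ?_ (convex_convexHull ℝ _)
  refine isCompact_bilinearBoxSet.subset_closure_convexHull_extremePoints.trans ?_
  exact closure_minimal (convexHull_mono (extremePoints_bilinearBoxSet_subset hN)) hc

end

/-! ### Decomposition into planar pieces -/

section

variable {N : ℕ} {a xl xu yl yu : Fin N → ℝ}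

/-- The part of `bilinearBoxSet` where the coordinate pairs other than the `i`-th one are at the
vertices of their boxes selected by `b` is an affine image of a planar hyperbola in a box. -/
theorem hasSOCHull_bilinearBoxSet_inter (ha : ∀ i, a i ≠ 0) (hx : ∀ i, xl i < xu i)
    (hy : ∀ i, yl i < yu i) (i : Fin N) (b : Fin N → Bool × Bool) :
    HasSOCHull (bilinearBoxSet a xl xu yl yu ∩ {z | ∀ j, j ≠ i →
      z.1 j = (if (b j).1 then xu j else xl j) ∧ z.2 j = if (b j).2 then yu j else yl j}) := by
  let v : Fin N → ℝ := fun j => if j = i then 0 else if (b j).1 then xu j else xl j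
  let w : Fin N → ℝ := fun j => if j = i then 0 else if (b j).2 then yu j else yl j
  let f : ℝ × ℝ →ᵃ[ℝ] (Fin N → ℝ) × (Fin N → ℝ) :=
    (LinearMap.prodMap (LinearMap.single ℝ (fun _ : Fin N => ℝ) i)
      (LinearMap.single ℝ (fun _ : Fin N => ℝ) i)).toAffineMap + AffineMap.const ℝ _ (v, w)
  have hfi : ∀ q, (f q).1 i = q.1 ∧ (f q).2 i = q.2 := fun q => by simp [f, v, w]
  have hfj : ∀ q j, j ≠ i → (f q).1 j = (if (b j).1 then xu j else xl j) ∧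
      (f q).2 j = if (b j).2 then yu j else yl j := fun q j hj => by simp [f, v, w, hj]
  -- The fixed pairs contribute `k` (`v` and `w` vanish at `i`), leaving the hyperbola `q.1 * q.2 =
  -- -k / a i`.
  set k := ∑ j, a j * v j * w j with hk
  have hsum : ∀ q, ∑ j, a j * (f q).1 j * (f q).2 j = a i * (q.1 * q.2) + k := by
    intro q
    rw [hk, ← Finset.add_sum_erase _ _ (Finset.mem_univ i),
      ← Finset.add_sum_erase _ (fun j => a j * v j * w j) (Finset.mem_univ i), (hfi q).1, (hfi q).2]
    have : ∑ j ∈ Finset.univ.erase i, a j * (f q).1 j * (f q).2 j =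
        ∑ j ∈ Finset.univ.erase i, a j * v j * w j :=
      Finset.sum_congr rfl fun j hj => by
        have hj := Finset.ne_of_mem_erase hj
        simp [hfj q j hj, v, w, hj]
    rw [this]
    simp [v, mul_assoc]
  have hmem : ∀ q, f q ∈ bilinearBoxSet a xl xu yl yu ↔
      q ∈ hyperbolaBox (-k / a i) (xl i) (xu i) (yl i) (yu i) := by
    intro q
    simp only [bilinearBoxSet, hyperbolaBox, Set.mem_ofPred_eq, hsum, eq_div_iff (ha i)]
    refine and_congr ⟨fun h => by linarith, fun h => by linarith⟩ (and_congr ?_ ?_)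
    · refine ⟨fun h => by simpa only [(hfi q).1] using h i, fun h j => ?_⟩
      by_cases hj : j = i
      · subst hj
        rwa [(hfi q).1]
      · rw [(hfj q j hj).1]
        split_ifs
        exacts [⟨(hx j).le, le_rfl⟩, ⟨le_rfl, (hx j).le⟩]
    · refine ⟨fun h => by simpa only [(hfi q).2] using h i, fun h j => ?_⟩
      by_cases hj : j = i
      · subst hj
        rwa [(hfi q).2]
      · rw [(hfj q j hj).2]
        split_ifs
        exacts [⟨(hy j).le, le_rfl⟩, ⟨le_rfl, (hy j).le⟩]
  convert (HasSOCHull.hyperbolaBox (-k / a i) (xl i) (xu i) (yl i) (yu i)).image f using 1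
  ext z
  constructor
  · rintro ⟨hz, hzv⟩
    have hfz : f (z.1 i, z.2 i) = z := by
      ext j <;> by_cases hj : j = i
      · rw [hj, (hfi _).1]
      · rw [(hfj _ j hj).1, (hzv j hj).1]
      · rw [hj, (hfi _).2]
      · rw [(hfj _ j hj).2, (hzv j hj).2]
    exact ⟨_, (hmem _).mp (hfz.symm ▸ hz), hfz⟩
  · rintro ⟨q, hq, rfl⟩
    exact ⟨(hmem q).mpr hq, hfj q⟩

theorem hasSOCHull_bilinearBoxSkeleton (ha : ∀ i, a i ≠ 0) (hx : ∀ i, xl i < xu i)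
    (hy : ∀ i, yl i < yu i) : HasSOCHull (bilinearBoxSkeleton a xl xu yl yu) := by
  convert HasSOCHull.iUnion fun i => HasSOCHull.iUnion
    (hasSOCHull_bilinearBoxSet_inter ha hx hy i) using 1
  ext z
  simp only [Set.mem_iUnion]
  constructor
  · rintro ⟨hz, i, h⟩
    refine ⟨i, fun j => (decide (z.1 j = xu j), decide (z.2 j = yu j)), hz, fun j hj => ?_⟩
    have h1 := h j hj
    simp only [decide_eq_true_eq]
    split_ifs <;> tauto
  · rintro ⟨i, b, hz, h⟩
    refine ⟨hz, i, fun j hj => ?_⟩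
    rw [(h j hj).1, (h j hj).2]
    split_ifs <;> simp

end

theorem mainTheorem1 (N : ℕ) (a xl xu yl yu : Fin N → ℝ)
    (ha : ∀ i, a i ≠ 0) (hx : ∀ i, xl i < xu i) (hy : ∀ i, yl i < yu i) :
    IsSOCRepresentable (convexHull ℝ (bilinearBoxSet a xl xu yl yu)) := by
  rcases Nat.eq_zero_or_pos N with rfl | hN
  -- Separate because the skeleton requires an index and is empty here, while the set is a point.
  · have h : bilinearBoxSet a xl xu yl yu = Set.univ := by
      ext z
      simp [bilinearBoxSet]
    rw [h, convexHull_univ]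
    exact IsSOCRepresentable.univ
  · have h := hasSOCHull_bilinearBoxSkeleton ha hx hy
    rw [convexHull_bilinearBoxSet_eq hN h.isCompact.isClosed]
    exact h.isSOCRepresentable
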